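/- Let $U(2,2)$ be the group of invertible complex $4\times4$ matrices $g$ with $g\sigma g^*=\sigma$, where $\sigma=\begin{pmatrix}0&e_2\\e_2&0\end{pmatrix}$ in $2\times2$ blocks. Let $N$ be the additive group of skew-Hermitian complex $2\times2$ matrices, let $S$ be the group of lower triangular complex $2\times2$ matrices with positive diagonal entries, and embed both in $U(2,2)$ by $n\mapsto\begin{pmatrix}e_2&0\\n&e_2\end{pmatrix}$ and $s\mapsto\begin{pmatrix}s^{*-1}&0\\0&s\end{pmatrix}$. Let $P\subset U(2,2)$ be the subgroup generated by $N$ and $S$; it is the semidirect product of $S$ and $N$ for the action $n\mapsto sns^*$. The group $S$ acts on the group $\hat N$ of continuous unitary characters of $N$ by $\chi_s(n)=\chi(sns^*)$. For each of the four pairs of signs $k=(\varepsilon_1,\varepsilon_2)$ consider the $S$-orbit in $\hat N$ of the character $n\mapsto\exp\bigl(i\,\mathrm{Re}\,\mathrm{tr}(\xi_k n^*)\bigr)$, $\xi_k=\mathrm{diag}(\varepsilon_1 i,\varepsilon_2 i)$, and fix a character $\chi_k$ in this orbit. A $\sigma$-finite Borel measure $\nu$ on $S$ is called almost invariant if $\nu(S)=\infty$,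 $\nu$ is absolutely continuous with respect to the right Haar measure of $S$, and for every $s_0\in S$ the measure $\nu_{s_0}(E)=\nu(Es_0)$ is absolutely continuous with respect to $\nu$ with $\nu$-essentially bounded derivative $\frac{d\nu(ss_0)}{d\nu(s)}$. For an almost invariant $\nu$ let $\pi_{k,\nu}$ be the representation of $P$ by bounded operators in $L^2(S,\nu)$ determined by $$(\pi_{k,\nu}(n)F)(s)=\chi_k(sns^*)F(s)\quad(n\in N),\qquad(\pi_{k,\nu}(s_0)F)(s)=F(ss_0)\quad(s_0\in S).$$ Theorem. (1) For every almost invariant measure $\nu$ and every $k$, the space $L^2(S,\nu)$ is nonzero and the representation $\pi_{k,\nu}$ is operator irreducible (every bounded operator in $L^2(S,\nu)$ that commutes with all $\pi_{k,\nu}(p)$, $p\in P$, is a scalar multiple of the identity) and space irreducible (the only closed $P$-invariant subspaces of $L^2(S,\nu)$ are $0$ and $L^2(S,\nu)$). (2) For almost invariant measures $\nu,\nu'$ and indices $k,k'$, the representations $\pi_{k,\nu}$ and $\pi_{k',\nu'}$ are space (unitarily) equivalent, i.e. there is a surjective linear isometry $L^2(S,\nu)\to L^2(S,\nu')$ intertwining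 them, if and only if $\nu'=c\nu$ for some constant $c>0$ and $k=k'$. -/

import Mathlib

open Matrix MeasureTheory
open scoped ENNReal NNReal

noncomputable section

namespace Iwasawa

/-! ### The group `U(2,2)` and its subgroups `N`, `S`, `P` -/

/-- Complex `2 × 2` matrices. -/
abbrev M2 : Type := Matrix (Fin 2) (Fin 2) ℂ

/-- Complex `4 × 4` matrices, written as `2 × 2` block matrices with `2 × 2` blocks. -/
abbrev M4 : Type := Matrix (Fin 2 ⊕ Fin 2) (Fin 2 ⊕ Fin 2) ℂ

/-- The matrix `σ` with blocks `0, e₂, e₂, 0`. -/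
def sigma : M4 := fromBlocks 0 1 1 0

/-- The group `U(2,2)` of all invertible `g` with `g σ g* = σ`. -/
def U22 : Subgroup (GL (Fin 2 ⊕ Fin 2) ℂ) where
  carrier := {g | (g : M4) * sigma * (g : M4)ᴴ = sigma}
  mul_mem' := by
    intro a b ha hb
    simp only [Set.mem_ofPred_eq, Units.val_mul, conjTranspose_mul] at *
    calc (a : M4) * b * sigma * ((b : M4)ᴴ * (a : M4)ᴴ)
        = (a : M4) * ((b : M4) * sigma * (b : M4)ᴴ) * (a : M4)ᴴ := by simp only [mul_assoc]
      _ = sigma := by rw [hb, ha]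
  one_mem' := by simp
  inv_mem' := by
    intro a ha
    simp only [Set.mem_ofPred_eq] at *
    have h1 : ((a⁻¹ : GL (Fin 2 ⊕ Fin 2) ℂ) : M4) * (a : M4) = 1 := a.inv_mul
    have h2 : (a : M4)ᴴ * ((a⁻¹ : GL (Fin 2 ⊕ Fin 2) ℂ) : M4)ᴴ = 1 := by
      rw [← conjTranspose_mul, h1, conjTranspose_one]
    calc ((a⁻¹ : GL (Fin 2 ⊕ Fin 2) ℂ) : M4) * sigma * ((a⁻¹ : GL (Fin 2 ⊕ Fin 2) ℂ) : M4)ᴴ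
        = ((a⁻¹ : GL (Fin 2 ⊕ Fin 2) ℂ) : M4) * ((a : M4) * sigma * (a : M4)ᴴ)
            * ((a⁻¹ : GL (Fin 2 ⊕ Fin 2) ℂ) : M4)ᴴ := by rw [ha]
      _ = (((a⁻¹ : GL (Fin 2 ⊕ Fin 2) ℂ) : M4) * (a : M4)) * sigma
            * ((a : M4)ᴴ * ((a⁻¹ : GL (Fin 2 ⊕ Fin 2) ℂ) : M4)ᴴ) := by simp only [mul_assoc]
      _ = sigma := by rw [h1, h2]; simp

/-- The additive group of skew-Hermitian `2 × 2` matrices, `n + n* = 0`. -/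
abbrev SkewHerm : AddSubgroup M2 := skewAdjoint M2

/-- The group `S` of lower triangular complex `2 × 2` matrices with positive diagonal. -/
def S : Subgroup (GL (Fin 2) ℂ) where
  carrier := {s | ∃ (r₁ r₂ : ℝ) (r : ℂ), 0 < r₁ ∧ 0 < r₂ ∧ (s : M2) = !![(r₁ : ℂ), 0; r, (r₂ : ℂ)]}
  mul_mem' := by
    rintro a b ⟨x, y, z, hx, hy, h⟩ ⟨x', y', z', hx', hy', h'⟩
    refine ⟨x * x', y * y', z * x' + y * z', by positivity, by positivity, ?_⟩
    rw [Units.val_mul, h, h']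
    simp
  one_mem' := ⟨1, 1, 0, one_pos, one_pos, by simp [Matrix.one_fin_two]⟩
  inv_mem' := by
    rintro a ⟨x, y, z, hx, hy, h⟩
    refine ⟨x⁻¹, y⁻¹, -(z * x⁻¹ * y⁻¹), by positivity, by positivity, ?_⟩
    have hx' : (x : ℂ) ≠ 0 := by exact_mod_cast hx.ne'
    have hy' : (y : ℂ) ≠ 0 := by exact_mod_cast hy.ne'
    refine Units.inv_eq_of_mul_eq_one_right ?_
    rw [h, Matrix.mul_fin_two, Matrix.one_fin_two]
    ext i j
    fin_cases i <;> fin_cases j <;> simp [hx', hy']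
    field_simp
    simp

/-- The matrix of an element of `S`. -/
abbrev mat (s : S) : M2 := ((s : GL (Fin 2) ℂ) : M2)

/-- The matrix of the inverse of an element of `S`. -/
abbrev imat (s : S) : M2 := (((s : GL (Fin 2) ℂ)⁻¹ : GL (Fin 2) ℂ) : M2)

theorem mat_imat (s : S) : (mat s) * (imat s) = 1 := (s : GL (Fin 2) ℂ).mul_inv

theorem imat_mat (s : S) : (imat s) * (mat s) = 1 := (s : GL (Fin 2) ℂ).inv_mul

theorem mat_imat_star (s : S) : (mat s)ᴴ * (imat s)ᴴ = 1 := by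
  rw [← conjTranspose_mul, imat_mat, conjTranspose_one]

theorem imat_mat_star (s : S) : (imat s)ᴴ * (mat s)ᴴ = 1 := by
  rw [← conjTranspose_mul, mat_imat, conjTranspose_one]

/-- The embedding of `SkewHerm` in `U(2,2)`: `n` goes to the matrix with blocks `e₂, 0, n, e₂`. -/
def embN : Multiplicative SkewHerm →* U22 where
  toFun n :=
    ⟨⟨fromBlocks 1 0 (n.toAdd : M2) 1, fromBlocks 1 0 (-(n.toAdd : M2)) 1,
      by simp [fromBlocks_multiply, ← fromBlocks_one],
      by simp [fromBlocks_multiply, ← fromBlocks_one]⟩, by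
      have h : ((n.toAdd : SkewHerm) : M2)ᴴ = -((n.toAdd : SkewHerm) : M2) :=
        skewAdjoint.mem_iff.1 n.toAdd.2
      change fromBlocks 1 0 (n.toAdd : M2) 1 * sigma * (fromBlocks 1 0 (n.toAdd : M2) 1)ᴴ = sigma
      simp [sigma, fromBlocks_conjTranspose, fromBlocks_multiply, h]⟩
  map_one' := by
    apply Subtype.ext; apply Units.ext
    change fromBlocks 1 0 (0 : M2) 1 = 1
    exact fromBlocks_one
  map_mul' a b := by
    apply Subtype.ext; apply Units.ext
    change fromBlocks 1 0 ((a.toAdd : M2) + (b.toAdd : M2)) 1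
      = fromBlocks 1 0 (a.toAdd : M2) 1 * fromBlocks 1 0 (b.toAdd : M2) 1
    simp [fromBlocks_multiply]

/-- The embedding of `S` in `U(2,2)`: `s` goes to the matrix with blocks `(s*)⁻¹, 0, 0, s`. -/
def embS : S →* U22 where
  toFun s :=
    ⟨⟨fromBlocks (imat s)ᴴ 0 0 (mat s), fromBlocks (mat s)ᴴ 0 0 (imat s),
      by simp only [fromBlocks_multiply, ← fromBlocks_one, imat_mat_star, mat_imat]; simp,
      by simp only [fromBlocks_multiply, ← fromBlocks_one, mat_imat_star, imat_mat]; simp⟩, by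
      change fromBlocks (imat s)ᴴ 0 0 (mat s) * sigma * (fromBlocks (imat s)ᴴ 0 0 (mat s))ᴴ = sigma
      simp only [sigma, fromBlocks_conjTranspose, fromBlocks_multiply]
      simp only [Matrix.mul_zero, Matrix.zero_mul, Matrix.mul_one, add_zero, zero_add,
        conjTranspose_zero, conjTranspose_conjTranspose, imat_mat_star, mat_imat]⟩
  map_one' := by
    apply Subtype.ext; apply Units.ext
    change fromBlocks (imat 1)ᴴ 0 0 (mat 1) = 1
    simp [imat, mat]
  map_mul' a b := by
    apply Subtype.ext; apply Units.ext
    change fromBlocks (imat (a * b))ᴴ 0 0 (mat (a * b))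
      = fromBlocks (imat a)ᴴ 0 0 (mat a) * fromBlocks (imat b)ᴴ 0 0 (mat b)
    simp [fromBlocks_multiply, imat, mat]

/-- The subgroup `P` of `U(2,2)` generated by (the images of) `N` and `S`. -/
def P : Subgroup U22 := embN.range ⊔ embS.range

/-- The element of `P` given by `n ∈ N`. -/
def P.ofN (n : SkewHerm) : P :=
  ⟨embN (Multiplicative.ofAdd n), Subgroup.mem_sup_left ⟨_, rfl⟩⟩

/-- The element of `P` given by `s ∈ S`. -/
def P.ofS (s : S) : P := ⟨embS s, Subgroup.mem_sup_right ⟨_, rfl⟩⟩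

/-! ### `P` as a semidirect product -/

/-- The action `n ↦ s n s*` of `S` on skew-Hermitian matrices. -/
def act (s : S) (n : SkewHerm) : SkewHerm :=
  ⟨(mat s) * (n : M2) * (mat s)ᴴ, by
    rw [skewAdjoint.mem_iff]
    have h : star (n : M2) = -(n : M2) := skewAdjoint.mem_iff.1 n.2
    rw [star_eq_conjTranspose] at h ⊢
    simp [conjTranspose_mul, h, mul_assoc]⟩

theorem act_one (n : SkewHerm) : act 1 n = n := by
  apply Subtype.ext; simp [act, mat]

theorem act_mul (s t : S) (n : SkewHerm) : act (s * t) n = act s (act t n) := by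
  apply Subtype.ext; simp [act, mat, mul_assoc]

theorem act_add (s : S) (n m : SkewHerm) : act s (n + m) = act s n + act s m := by
  apply Subtype.ext; simp [act, mul_add, add_mul]

/-- The action of `S` on `N` by group automorphisms. -/
def actHom : S →* MulAut (Multiplicative SkewHerm) where
  toFun s :=
    { toFun := fun n => Multiplicative.ofAdd (act s n.toAdd)
      invFun := fun n => Multiplicative.ofAdd (act s⁻¹ n.toAdd)
      left_inv := fun n => by simp [← act_mul, act_one]
      right_inv := fun n => by simp [← act_mul, act_one]
      map_mul' := fun n m => by simp [act_add] }
  map_one' := by ext n : 1; simp [act_one]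
  map_mul' s t := by ext n : 1; simp [act_mul]

/-- The semidirect product of `S` and `N`. -/
abbrev Q : Type := Multiplicative SkewHerm ⋊[actHom] S

/-- The homomorphism `(n, s) ↦ n s` from the semidirect product to `U(2,2)`. -/
def embQ : Q →* U22 := SemidirectProduct.lift embN embS (by
  intro s
  refine MonoidHom.ext fun n => ?_
  simp only [MonoidHom.comp_apply, MulEquiv.coe_toMonoidHom, MulAut.conj_apply]
  rw [eq_mul_inv_iff_mul_eq]
  apply Subtype.ext; apply Units.ext
  change fromBlocks 1 0 ((mat s) * (n.toAdd : M2) * (mat s)ᴴ) 1 * fromBlocks (imat s)ᴴ 0 0 (mat s)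
      = fromBlocks (imat s)ᴴ 0 0 (mat s) * fromBlocks 1 0 (n.toAdd : M2) 1
  simp only [fromBlocks_multiply]
  simp only [Matrix.mul_zero, Matrix.zero_mul, Matrix.mul_one, Matrix.one_mul, add_zero, zero_add,
    mul_assoc, mat_imat_star])

theorem embQ_injective : Function.Injective embQ := by
  rw [injective_iff_map_eq_one]
  intro q hq
  have h : fromBlocks 1 0 (q.left.toAdd : M2) 1 * fromBlocks (imat q.right)ᴴ 0 0 (mat q.right)
      = (1 : M4) := congrArg (fun u : U22 => ((u : GL (Fin 2 ⊕ Fin 2) ℂ) : M4)) hq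
  simp only [fromBlocks_multiply, Matrix.one_mul, Matrix.zero_mul, Matrix.mul_zero, add_zero,
    zero_add, ← fromBlocks_one] at h
  obtain ⟨h11, -, h21, h22⟩ := fromBlocks_inj.1 h
  rw [h11, Matrix.mul_one] at h21
  apply SemidirectProduct.ext
  · exact Subtype.ext h21
  · exact Subtype.ext (Units.ext h22)

theorem embQ_range : embQ.range = P := by
  apply le_antisymm
  · rintro _ ⟨q, rfl⟩
    exact P.mul_mem (P.ofN q.left.toAdd).2 (P.ofS q.right).2
  · refine sup_le ?_ ?_
    · rintro _ ⟨n, rfl⟩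
      exact ⟨SemidirectProduct.inl n, by simp [embQ]⟩
    · rintro _ ⟨s, rfl⟩
      exact ⟨SemidirectProduct.inr s, by simp [embQ]⟩

/-- The group `P` is isomorphic to the semidirect product, `(n, s)` corresponding to `n s ∈ P`. -/
def equivQ : Q ≃* P :=
  (MonoidHom.ofInjective embQ_injective).trans (MulEquiv.subgroupCongr embQ_range)

theorem equivQ_inl (n : SkewHerm) :
    equivQ (SemidirectProduct.inl (Multiplicative.ofAdd n)) = P.ofN n := by
  apply Subtype.ext
  change embQ (SemidirectProduct.inl (Multiplicative.ofAdd n)) = embN _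
  simp [embQ]

theorem equivQ_inr (s : S) : equivQ (SemidirectProduct.inr s) = P.ofS s := by
  apply Subtype.ext
  change embQ (SemidirectProduct.inr s) = embS _
  simp [embQ]

/-! ### Characters of `N` and the four nondegenerate orbits -/

/-- The group `N̂` of continuous unitary characters of `N`. -/
abbrev NHat : Type := PontryaginDual (Multiplicative SkewHerm)

/-- The value `χ(n)` as a complex number. -/
def ev (χ : NHat) (n : SkewHerm) : ℂ := ((χ (Multiplicative.ofAdd n) : Circle) : ℂ)

theorem continuous_act (s : S) : Continuous (act s) := by
  unfold act
  fun_prop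

/-- The action of `S` on characters: `χ_s(n) = χ(s n s*)`. -/
def charAct (χ : NHat) (s : S) : NHat :=
  ContinuousMonoidHom.comp χ
    { toMonoidHom := (actHom s).toMonoidHom
      continuous_toFun := continuous_ofAdd.comp ((continuous_act s).comp continuous_toAdd) }

theorem ev_charAct (χ : NHat) (s : S) (n : SkewHerm) : ev (charAct χ s) n = ev χ (act s n) := rfl

/-- The skew-Hermitian matrix with diagonal entries `±i, ±i`, the signs being given by `k`. -/
def diagMat (k : ℤˣ × ℤˣ) : M2 :=
  !![((k.1 : ℤ) : ℂ) * Complex.I, 0; 0, ((k.2 : ℤ) : ℂ) * Complex.I]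

/-- The character `n ↦ exp(i Re tr(ξ n*))` of `N` given by a matrix `ξ`; for skew-Hermitian `ξ`
this is the usual identification of `N` with `N̂`. -/
def charOf (ξ : M2) : NHat :=
  { toFun := fun n => Circle.exp (ξ * ((n.toAdd : SkewHerm) : M2)ᴴ).trace.re
    map_one' := by simp
    map_mul' := fun n m => by simp [mul_add, Circle.exp_add]
    continuous_toFun := by
      have h : Continuous fun n : Multiplicative SkewHerm => ((n.toAdd : SkewHerm) : M2) :=
        continuous_subtype_val.comp continuous_toAdd
      exact Circle.exp.continuous.comp (Complex.continuous_re.comp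
        (continuous_const.matrix_mul h.matrix_conjTranspose).matrix_trace) }

/-- The nondegenerate orbit of `S` in `N̂` with index `k`: the orbit of `diag(±i, ±i)`. -/
def charOrbit (k : ℤˣ × ℤˣ) : Set NHat := Set.range (charAct (charOf (diagMat k)))

/-! ### Almost invariant measures on `S` -/

instance : MeasurableSpace S := borel S

instance : BorelSpace S := ⟨rfl⟩

/-- `μ` is a right Haar measure on the topological group `G`. -/
structure IsRightHaar {G : Type*} [Group G] [TopologicalSpace G] [MeasurableSpace G]
    (μ : Measure G) : Prop where
  finiteOnCompacts : IsFiniteMeasureOnCompacts μ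
  openPos : μ.IsOpenPosMeasure
  rightInvariant : μ.IsMulRightInvariant

/-- The measure `dν(s s₀)`, i.e. `E ↦ ν(E s₀)`. -/
def translate (ν : Measure S) (s₀ : S) : Measure S := ν.map (fun s => s * s₀⁻¹)

/-- Right almost invariant measures on `S`: infinite (`σ`-finite) measures, absolutely continuous
with respect to the right Haar measure, such that for every `s₀` the derivative
`dν(s s₀) / dν(s)` exists and is bounded. -/
structure IsAlmostInvariant (ν : Measure S) : Prop where
  sigmaFinite : SigmaFinite ν
  infinite : ν Set.univ = ∞
  absCont : ∃ μ : Measure S, IsRightHaar μ ∧ ν ≪ μ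
  translate_absCont : ∀ s₀ : S, translate ν s₀ ≪ ν
  translate_bounded : ∀ s₀ : S, ∃ C : ℝ≥0, ∀ᵐ s ∂ν, (translate ν s₀).rnDeriv ν s ≤ C

theorem continuous_mat : Continuous mat := Units.continuous_val.comp continuous_subtype_val

theorem measurable_mul_right (s₀ : S) : Measurable (fun s : S => s * s₀) :=
  (continuous_mul_const s₀).measurable

theorem sigmaFinite_translate {ν : Measure S} (hν : SigmaFinite ν) (s₀ : S) :
    SigmaFinite (translate ν s₀) :=
  (Homeomorph.mulRight s₀⁻¹).toMeasurableEquiv.sigmaFinite_map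

theorem IsAlmostInvariant.map_absCont {ν : Measure S} (hν : IsAlmostInvariant ν) (s₀ : S) :
    ν.map (fun s => s * s₀) ≪ ν := by
  simpa [translate] using hν.translate_absCont s₀⁻¹

theorem IsAlmostInvariant.exists_map_le {ν : Measure S} (hν : IsAlmostInvariant ν) (s₀ : S) :
    ∃ C : ℝ≥0, ν.map (fun s => s * s₀) ≤ (C : ℝ≥0∞) • ν := by
  have := hν.sigmaFinite
  have := sigmaFinite_translate hν.sigmaFinite s₀⁻¹
  obtain ⟨C, hC⟩ := hν.translate_bounded s₀⁻¹
  refine ⟨C, ?_⟩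
  have h : ν.map (fun s => s * s₀) = translate ν s₀⁻¹ := by simp [translate]
  rw [h, ← Measure.withDensity_rnDeriv_eq _ _ (hν.translate_absCont s₀⁻¹),
    ← withDensity_const]
  exact withDensity_mono hC

/-! ### The representation of `P` in `L²(S, ν)` -/

theorem continuous_ev (χ : NHat) : Continuous (ev χ) := by
  have h2 : Continuous fun m : Multiplicative SkewHerm => χ m :=
    ContinuousMonoidHom.continuous_toFun χ
  exact continuous_subtype_val.comp (h2.comp continuous_ofAdd)

theorem continuous_ev_act (χ : NHat) (n : SkewHerm) : Continuous fun s : S => ev χ (act s n) := by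
  have h1 : Continuous fun s : S => act s n := by
    refine Continuous.subtype_mk ?_ _
    exact (continuous_mat.matrix_mul continuous_const).matrix_mul
      continuous_mat.matrix_conjTranspose
  exact (continuous_ev χ).comp h1

theorem norm_ev (χ : NHat) (n : SkewHerm) : ‖ev χ n‖ = 1 := Circle.norm_coe _

/-- The function `s ↦ χ(s n s*) F(s s₀)`. -/
def opFun (χ : NHat) (n : SkewHerm) (s₀ : S) (F : S → ℂ) : S → ℂ :=
  fun s => ev χ (act s n) * F (s * s₀)

theorem opFun_congr {ν : Measure S} (hν : IsAlmostInvariant ν) (χ : NHat) (n : SkewHerm) (s₀ : S)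
    {F G : S → ℂ} (h : F =ᵐ[ν] G) : opFun χ n s₀ F =ᵐ[ν] opFun χ n s₀ G := by
  have h' := ae_of_ae_map (measurable_mul_right s₀).aemeasurable ((hν.map_absCont s₀).ae_le h)
  filter_upwards [h'] with s hs
  simp only [opFun, hs]

theorem eLpNorm_opFun {ν : Measure S} (hν : IsAlmostInvariant ν) (χ : NHat) (n : SkewHerm) (s₀ : S)
    {F : S → ℂ} (hF : AEStronglyMeasurable F ν) :
    eLpNorm (opFun χ n s₀ F) 2 ν = eLpNorm F 2 (ν.map (fun s => s * s₀)) := by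
  rw [eLpNorm_map_measure (hF.mono_ac (hν.map_absCont s₀)) (measurable_mul_right s₀).aemeasurable]
  refine eLpNorm_congr_norm_ae (Filter.Eventually.of_forall fun s => ?_)
  simp [opFun, norm_ev]

theorem exists_eLpNorm_opFun_le {ν : Measure S} (hν : IsAlmostInvariant ν) (s₀ : S) :
    ∃ K : ℝ≥0, ∀ (χ : NHat) (n : SkewHerm) (F : S → ℂ), AEStronglyMeasurable F ν →
      eLpNorm (opFun χ n s₀ F) 2 ν ≤ K * eLpNorm F 2 ν := by
  obtain ⟨C, hC⟩ := hν.exists_map_le s₀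
  refine ⟨C ^ ((1 : ℝ) / 2), fun χ n F hF => ?_⟩
  rw [eLpNorm_opFun hν χ n s₀ hF]
  refine (eLpNorm_le_of_measure_le_smul hC).trans (le_of_eq ?_)
  rw [ENNReal.coe_rpow_of_nonneg _ (by norm_num)]
  simp

theorem aestronglyMeasurable_opFun {ν : Measure S} (hν : IsAlmostInvariant ν) (χ : NHat)
    (n : SkewHerm) (s₀ : S) {F : S → ℂ} (hF : AEStronglyMeasurable F ν) :
    AEStronglyMeasurable (opFun χ n s₀ F) ν :=
  ((continuous_ev_act χ n).measurable.aestronglyMeasurable).mul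
    ((hF.mono_ac (hν.map_absCont s₀)).comp_measurable (measurable_mul_right s₀))

theorem memLp_opFun {ν : Measure S} (hν : IsAlmostInvariant ν) (χ : NHat) (n : SkewHerm) (s₀ : S)
    {F : S → ℂ} (hF : MemLp F 2 ν) : MemLp (opFun χ n s₀ F) 2 ν := by
  obtain ⟨K, hK⟩ := exists_eLpNorm_opFun_le hν s₀
  exact ⟨aestronglyMeasurable_opFun hν χ n s₀ hF.1,
    (hK χ n F hF.1).trans_lt (ENNReal.mul_lt_top ENNReal.coe_lt_top hF.2)⟩

/-- The bounded operator `(T(n s₀) F)(s) = χ(s n s*) F(s s₀)` in `L²(S, ν)`. -/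
def op (χ : NHat) {ν : Measure S} (hν : IsAlmostInvariant ν) (n : SkewHerm) (s₀ : S) :
    Lp ℂ 2 ν →L[ℂ] Lp ℂ 2 ν :=
  LinearMap.mkContinuousOfExistsBound
    { toFun := fun F => (memLp_opFun hν χ n s₀ (Lp.memLp F)).toLp
      map_add' := fun F G => by
        rw [← MemLp.toLp_add, MemLp.toLp_eq_toLp_iff]
        refine (opFun_congr hν χ n s₀ (Lp.coeFn_add F G)).trans ?_
        refine Filter.Eventually.of_forall fun s => ?_
        simp [opFun, mul_add]
      map_smul' := fun c F => by
        rw [RingHom.id_apply, ← MemLp.toLp_const_smul, MemLp.toLp_eq_toLp_iff]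
        refine (opFun_congr hν χ n s₀ (Lp.coeFn_smul c F)).trans ?_
        refine Filter.Eventually.of_forall fun s => ?_
        simp [opFun, mul_left_comm] }
    (by
      obtain ⟨K, hK⟩ := exists_eLpNorm_opFun_le hν s₀
      refine ⟨K, fun F => ?_⟩
      have h := ENNReal.toReal_mono (ENNReal.mul_ne_top ENNReal.coe_ne_top (Lp.memLp F).2.ne)
        (hK χ n F (Lp.memLp F).1)
      rw [ENNReal.toReal_mul] at h
      change ‖(memLp_opFun hν χ n s₀ (Lp.memLp F)).toLp‖ ≤ K * ‖F‖
      rw [Lp.norm_toLp, Lp.norm_def]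
      exact h)

theorem op_coeFn (χ : NHat) {ν : Measure S} (hν : IsAlmostInvariant ν) (n : SkewHerm) (s₀ : S)
    (F : Lp ℂ 2 ν) : op χ hν n s₀ F =ᵐ[ν] opFun χ n s₀ F :=
  MemLp.coeFn_toLp (memLp_opFun hν χ n s₀ (Lp.memLp F))

theorem ev_add (χ : NHat) (n m : SkewHerm) : ev χ (n + m) = ev χ n * ev χ m := by
  simp [ev, ofAdd_add]

theorem ev_zero (χ : NHat) : ev χ 0 = 1 := by simp [ev]

/-- The representation `n s₀ ↦ T(n s₀)` of the semidirect product. -/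
def repQ (χ : NHat) {ν : Measure S} (hν : IsAlmostInvariant ν) :
    Q →* (Lp ℂ 2 ν →L[ℂ] Lp ℂ 2 ν) where
  toFun q := op χ hν q.left.toAdd q.right
  map_one' := by
    ext1 F
    apply Lp.ext
    refine (op_coeFn χ hν _ _ F).trans (Filter.Eventually.of_forall fun s => ?_)
    have h : act s 0 = 0 := Subtype.ext (by simp [act])
    simp [opFun, h, ev_zero]
  map_mul' p q := by
    ext1 F
    apply Lp.ext
    refine (op_coeFn χ hν _ _ F).trans ?_
    refine Filter.EventuallyEq.symm ((op_coeFn χ hν _ _ _).trans ?_)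
    refine (opFun_congr hν χ _ _ (op_coeFn χ hν _ _ F)).trans
      (Filter.Eventually.of_forall fun s => ?_)
    have h : (p * q).left.toAdd = p.left.toAdd + act p.right q.left.toAdd := rfl
    simp only [opFun, h, act_add, ev_add, SemidirectProduct.mul_right, act_mul, mul_assoc]

/-- The representation `π` of `P` in `L²(S, ν)` built from the measure `ν` and the character `χ`:
`(π(n) F)(s) = χ(s n s*) F(s)` for `n ∈ N` and `(π(s₀) F)(s) = F(s s₀)` for `s₀ ∈ S`. -/
def rep (χ : NHat) {ν : Measure S} (hν : IsAlmostInvariant ν) :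
    P →* (Lp ℂ 2 ν →L[ℂ] Lp ℂ 2 ν) :=
  (repQ χ hν).comp equivQ.symm.toMonoidHom

theorem rep_ofN (χ : NHat) {ν : Measure S} (hν : IsAlmostInvariant ν) (n : SkewHerm)
    (F : Lp ℂ 2 ν) :
    rep χ hν (P.ofN n) F =ᵐ[ν] fun s => ev χ (act s n) * F s := by
  have h : rep χ hν (P.ofN n) = op χ hν n 1 := by
    simp [rep, ← equivQ_inl, repQ]
  rw [h]
  refine (op_coeFn χ hν _ _ F).trans (Filter.Eventually.of_forall fun s => ?_)
  simp [opFun]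

theorem rep_ofS (χ : NHat) {ν : Measure S} (hν : IsAlmostInvariant ν) (s₀ : S) (F : Lp ℂ 2 ν) :
    rep χ hν (P.ofS s₀) F =ᵐ[ν] fun s => F (s * s₀) := by
  have h : rep χ hν (P.ofS s₀) = op χ hν 0 s₀ := by
    simp [rep, ← equivQ_inr, repQ]
  rw [h]
  refine (op_coeFn χ hν _ _ F).trans (Filter.Eventually.of_forall fun s => ?_)
  have h : act s 0 = 0 := Subtype.ext (by simp [act])
  simp [opFun, h, ev_zero]

/-! ### Irreducibility and equivalence -/

section Irreducibility

variable {G : Type*} [Group G] {H : Type*} [NormedAddCommGroup H] [InnerProductSpace ℂ H]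
  {H' : Type*} [NormedAddCommGroup H'] [InnerProductSpace ℂ H']

/-- Operator irreducibility: every bounded operator commuting with the representation is scalar. -/
def OperatorIrreducible (π : G →* (H →L[ℂ] H)) : Prop :=
  Nontrivial H ∧ ∀ A : H →L[ℂ] H, (∀ g, A * π g = π g * A) →
    ∃ c : ℂ, A = c • (1 : H →L[ℂ] H)

/-- Space irreducibility: there are no closed invariant subspaces except `0` and `H ≠ 0`. -/
def SpaceIrreducible (π : G →* (H →L[ℂ] H)) : Prop :=
  Nontrivial H ∧ ∀ M : Submodule ℂ H, IsClosed (M : Set H) → (∀ g, ∀ x ∈ M, π g x ∈ M) →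
    M = ⊥ ∨ M = ⊤

/-- Unitary equivalence: there is a surjective linear isometry intertwining the representations. -/
def UnitarilyEquivalent (π : G →* (H →L[ℂ] H)) (π' : G →* (H' →L[ℂ] H')) : Prop :=
  ∃ U : H ≃ₗᵢ[ℂ] H', ∀ g x, U (π g x) = π' g (U x)

end Irreducibility

end Iwasawa

end

/-!
The proof rests on the fact that the functions `s ↦ χ(s n s*)` separate the points of `S`. In the
coordinates of `orbitCoord`, these functions are the characters `exp(i ⟪·, t⟫)` of `ℝ⁴` composed
with the map `s ↦ s* ξ s`, which is continuous and injective; since `S` is Polish, it is a Borel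
isomorphism onto its image, and the images for the four sign pairs are disjoint (`orbitCoord_inj`).

Let `T : L²(ν) → L²(ν')` be a bounded operator that intertwines the action of `N`. For each pair
`F`, `K`, the two expressions for `⟪K, T (e F)⟫`, with `e` a character, are the Fourier transforms
of two complex measures on `ℝ⁴`, which therefore coincide (`integral_comp_mul_eq`). So `T`
intertwines multiplication by every bounded measurable function of the orbit coordinates
(`intertwines_comp`). If the two indices differ, the indicator of one orbit shows `T = 0`
(`eq_zero_of_intertwines_ofN`). If they are equal, `T` commutes with all bounded measurable
multipliers and is itself multiplication by a function `φ` (`exists_eq_mul`). If `T` moreover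
intertwines the action of `S`, then `φ(s t) = φ(s)` almost everywhere for each `t`, and by Fubini
against Haar measure `φ` is constant (`exists_ae_eq_const`, `exists_eq_const_mul`).

Operator irreducibility follows at once. Although `S` need not act by unitary operators, `N` does,
so the orthogonal projection onto a closed invariant subspace commutes with `N` and is
multiplication by a function `φ`; invariance of the subspace under `t` and `t⁻¹` makes `φ` invariant, hence
constant. A unitary equivalence is multiplication by a constant `c`, and comparing the norms of
indicator functions gives `ν = |c|² ν'`; conversely, scaling by `c^(-1/2)` is a unitary equivalence
between `L²(ν)` and `L²(c ν)`.
-/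

namespace Iwasawa

/-! ### Topology of `S` and ergodicity of right translations -/

theorem isClosed_S : IsClosed (S : Set (GL (Fin 2) ℂ)) := by
  have h : (S : Set (GL (Fin 2) ℂ)) = {g : GL (Fin 2) ℂ | (g : M2) 0 1 = 0 ∧ ((g : M2) 0 0).im = 0 ∧
      ((g : M2) 1 1).im = 0 ∧ 0 ≤ ((g : M2) 0 0).re ∧ 0 ≤ ((g : M2) 1 1).re} := by
    ext g
    constructor
    · rintro ⟨r₁, r₂, r, h₁, h₂, h⟩
      simp [h, h₁.le, h₂.le]
    · rintro ⟨h01, h0, h1, h0', h1'⟩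
      have hdet : (g : M2).det ≠ 0 := by
        simpa using ((Matrix.isUnit_iff_isUnit_det _).1 g.isUnit)
      rw [det_fin_two, h01, zero_mul, sub_zero] at hdet
      have e0 : (g : M2) 0 0 = (((g : M2) 0 0).re : ℂ) := Complex.ext (by simp) (by simp [h0])
      have e1 : (g : M2) 1 1 = (((g : M2) 1 1).re : ℂ) := Complex.ext (by simp) (by simp [h1])
      refine ⟨((g : M2) 0 0).re, ((g : M2) 1 1).re, (g : M2) 1 0, ?_, ?_, ?_⟩
      · refine h0'.lt_of_ne fun h => hdet ?_
        rw [e0, ← h]; simp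
      · refine h1'.lt_of_ne fun h => hdet ?_
        rw [e1, ← h]; simp
      · rw [← e0, ← e1]
        ext i j
        fin_cases i <;> fin_cases j <;> simp [h01]
  rw [h]
  have hc : ∀ i j, Continuous fun g : GL (Fin 2) ℂ => (g : M2) i j := fun i j =>
    Units.continuous_val.matrix_elem i j
  refine (isClosed_eq (hc 0 1) continuous_const).inter
    ((isClosed_eq (Complex.continuous_im.comp (hc 0 0)) continuous_const).inter
    ((isClosed_eq (Complex.continuous_im.comp (hc 1 1)) continuous_const).inter
    ((isClosed_le continuous_const (Complex.continuous_re.comp (hc 0 0))).inter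
    (isClosed_le continuous_const (Complex.continuous_re.comp (hc 1 1))))))

theorem isClosedEmbedding_S :
    Topology.IsClosedEmbedding fun s : S => Units.embedProduct M2 (s : GL (Fin 2) ℂ) :=
  Units.isClosedEmbedding_embedProduct.comp isClosed_S.isClosedEmbedding_subtypeVal

instance : PolishSpace M2 := inferInstanceAs (PolishSpace (Fin 2 → Fin 2 → ℂ))

instance : SigmaCompactSpace M2 := inferInstanceAs (SigmaCompactSpace (Fin 2 → Fin 2 → ℂ))

instance : PolishSpace S :=
  have : PolishSpace M2ᵐᵒᵖ := MulOpposite.opHomeomorph.symm.isClosedEmbedding.polishSpace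
  isClosedEmbedding_S.polishSpace

instance : SigmaCompactSpace S :=
  have : SigmaCompactSpace M2ᵐᵒᵖ :=
    MulOpposite.opHomeomorph.symm.isClosedEmbedding.sigmaCompactSpace
  isClosedEmbedding_S.sigmaCompactSpace

theorem IsRightHaar.sigmaFinite {μ : Measure S} (hμ : IsRightHaar μ) : SigmaFinite μ := by
  have := hμ.finiteOnCompacts
  exact ⟨⟨⟨compactCovering S, fun _ => trivial,
    fun n => (isCompact_compactCovering S n).measure_lt_top, iUnion_compactCovering S⟩⟩⟩

/-- Right translations of `S` are ergodic for any measure absolutely continuous with respect to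
Haar measure: by Fubini, `φ (s * t) = φ s` holds for some `s` and Haar-almost every `t`. -/
theorem exists_ae_eq_const {ν : Measure S} [SigmaFinite ν]
    (hac : ∃ μ : Measure S, IsRightHaar μ ∧ ν ≪ μ) (hν : ν ≠ 0) {φ : S → ℂ} (hφ : Measurable φ)
    (h : ∀ t : S, ∀ᵐ s ∂ν, φ (s * t) = φ s) : ∃ c : ℂ, ∀ᵐ s ∂ν, φ s = c := by
  obtain ⟨μ, hμ, hνμ⟩ := hac
  have := hμ.sigmaFinite
  have := hμ.rightInvariant
  have hm : MeasurableSet {x : S × S | φ (x.2 * x.1) = φ x.2} :=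
    measurableSet_eq_fun (hφ.comp (measurable_snd.mul measurable_fst)) (hφ.comp measurable_snd)
  have h1 : ∀ᵐ x ∂(μ.prod ν), φ (x.2 * x.1) = φ x.2 :=
    (Measure.ae_prod_iff_ae_ae hm).2 (Filter.Eventually.of_forall h)
  have h2 : ∀ᵐ x ∂(ν.prod μ), φ (x.1 * x.2) = φ x.1 :=
    Measure.measurePreserving_swap.quasiMeasurePreserving.ae h1
  have : (ae ν).NeBot := ae_neBot.2 hν
  obtain ⟨s, hs⟩ := (Measure.ae_ae_of_ae_prod h2).exists
  refine ⟨φ s, hνμ.ae_le ?_⟩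
  filter_upwards [(quasiMeasurePreserving_mul_left μ s⁻¹).ae hs] with t ht
  simpa using ht

/-! ### Fourier uniqueness for complex densities -/

section PosPart

variable {X V : Type*} [MeasurableSpace X] [MeasurableSpace V] {ν : Measure X} {ψ : X → V}

theorem integrable_comp_mul (hψ : Measurable ψ) {h : X → ℂ} (hh : Integrable h ν) {m : V → ℂ}
    (hm : Measurable m) {C : ℝ} (hC : ∀ v, ‖m v‖ ≤ C) :
    Integrable (fun x => m (ψ x) * h x) ν :=
  hh.bdd_mul (hm.comp hψ).aestronglyMeasurable (Filter.Eventually.of_forall fun x => hC (ψ x))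

theorem memLp_comp_mul (hψ : Measurable ψ) (F : Lp ℂ 2 ν) {m : V → ℂ} (hm : Measurable m) {C : ℝ}
    (hC : ∀ v, ‖m v‖ ≤ C) : MemLp (fun x => m (ψ x) * F x) 2 ν := by
  refine (Lp.memLp F).of_le_mul (c := C)
    ((hm.comp hψ).aestronglyMeasurable.mul (Lp.aestronglyMeasurable F))
    (Filter.Eventually.of_forall fun x => ?_)
  rw [norm_mul]
  gcongr
  exact hC _

theorem integral_comp_mul_re_add_im (hψ : Measurable ψ) {h : X → ℂ} (hh : Integrable h ν)
    {m : V → ℂ} (hm : Measurable m) {C : ℝ} (hC : ∀ v, ‖m v‖ ≤ C) :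
    ∫ x, m (ψ x) * h x ∂ν = ∫ x, m (ψ x) * ((h x).re : ℂ) ∂ν
      + Complex.I * ∫ x, m (ψ x) * ((h x).im : ℂ) ∂ν := by
  have hr : Integrable (fun x => m (ψ x) * ((h x).re : ℂ)) ν :=
    integrable_comp_mul hψ hh.re.ofReal hm hC
  have hi : Integrable (fun x => m (ψ x) * ((h x).im : ℂ)) ν :=
    integrable_comp_mul hψ hh.im.ofReal hm hC
  rw [← integral_const_mul, ← integral_add hr (hi.const_mul _)]
  refine integral_congr_ae (Filter.Eventually.of_forall fun x => ?_)
  simp only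
  conv_lhs => rw [← Complex.re_add_im (h x)]
  ring

/-- The image under `ψ` of the measure with density the positive part of `h`. -/
noncomputable def mapPosPart (ν : Measure X) (ψ : X → V) (h : X → ℝ) : Measure V :=
  (ν.withDensity fun x => ENNReal.ofReal (h x)).map ψ

theorem isFiniteMeasure_mapPosPart {h : X → ℝ} (hh : Integrable h ν) :
    IsFiniteMeasure (mapPosPart ν ψ h) := by
  have := isFiniteMeasure_withDensity_ofReal hh.2
  unfold mapPosPart; infer_instance

theorem integral_comp_mul_ofReal (hψ : Measurable ψ) {h : X → ℝ} (hmeas : Measurable h)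
    (hh : Integrable h ν) {m : V → ℂ} (hm : Measurable m) {C : ℝ} (hC : ∀ v, ‖m v‖ ≤ C) :
    ∫ x, m (ψ x) * (h x : ℂ) ∂ν
      = ∫ v, m v ∂mapPosPart ν ψ h - ∫ v, m v ∂mapPosPart ν ψ (fun x => -h x) := by
  have key : ∀ g : X → ℝ, Measurable g →
      ∫ v, m v ∂mapPosPart ν ψ g = ∫ x, m (ψ x) * ((max (g x) 0 : ℝ) : ℂ) ∂ν := by
    intro g hg
    rw [mapPosPart, integral_map hψ.aemeasurable hm.aestronglyMeasurable,
      integral_withDensity_eq_integral_toReal_smul hg.ennreal_ofReal (by simp)]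
    refine integral_congr_ae (Filter.Eventually.of_forall fun x => ?_)
    simp only [ENNReal.toReal_ofReal', Complex.real_smul, mul_comm]
  rw [key _ hmeas, key (fun x => -h x) hmeas.neg, ← integral_sub]
  · refine integral_congr_ae (Filter.Eventually.of_forall fun x => ?_)
    simp only
    rw [← mul_sub, ← Complex.ofReal_sub, max_zero_sub_max_neg_zero_eq_self]
  · exact integrable_comp_mul hψ hh.pos_part.ofReal hm hC
  · exact integrable_comp_mul hψ hh.neg_part.ofReal hm hC

end PosPart

section Fourier

variable {V : Type*} [NormedAddCommGroup V] [InnerProductSpace ℝ V]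

/-- The character `exp(i ⟪v, t⟫)` of a real inner product space. -/
noncomputable def expInner (t v : V) : ℂ := Complex.exp (inner ℝ v t * Complex.I)

theorem continuous_expInner (t : V) : Continuous (expInner t) := by
  unfold expInner; fun_prop

theorem norm_expInner (t v : V) : ‖expInner t v‖ = 1 := Complex.norm_exp_ofReal_mul_I _

theorem conj_expInner (t v : V) : starRingEnd ℂ (expInner t v) = expInner (-t) v := by
  simp [expInner, ← Complex.exp_conj]

variable {X X' : Type*} [MeasurableSpace X] [MeasurableSpace X'] [MeasurableSpace V] [BorelSpace V]
  {ν : Measure X} {ν' : Measure X'} {ψ : X → V} {ψ' : X' → V}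

theorem integrable_expInner_mul (hψ : Measurable ψ) {h : X → ℂ} (hh : Integrable h ν) (t : V) :
    Integrable (fun x => expInner t (ψ x) * h x) ν :=
  integrable_comp_mul hψ hh (continuous_expInner t).measurable fun v => (norm_expInner t v).le

variable [SecondCountableTopology V] [CompleteSpace V]

theorem integral_comp_mul_ofReal_eq (hψ : Measurable ψ) (hψ' : Measurable ψ') {h : X → ℝ}
    {h' : X' → ℝ} (hm : Measurable h) (hm' : Measurable h') (hh : Integrable h ν)
    (hh' : Integrable h' ν')
    (H : ∀ t, ∫ x, expInner t (ψ x) * (h x : ℂ) ∂ν = ∫ x, expInner t (ψ' x) * (h' x : ℂ) ∂ν')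
    {m : V → ℂ} (hmm : Measurable m) {C : ℝ} (hC : ∀ v, ‖m v‖ ≤ C) :
    ∫ x, m (ψ x) * (h x : ℂ) ∂ν = ∫ x, m (ψ' x) * (h' x : ℂ) ∂ν' := by
  have := isFiniteMeasure_mapPosPart (ψ := ψ) hh
  have := isFiniteMeasure_mapPosPart (ψ := ψ) hh.neg
  have := isFiniteMeasure_mapPosPart (ψ := ψ') hh'
  have := isFiniteMeasure_mapPosPart (ψ := ψ') hh'.neg
  have hint : ∀ (μ : Measure V) [IsFiniteMeasure μ] {f : V → ℂ}, Measurable f → ∀ D : ℝ,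
      (∀ v, ‖f v‖ ≤ D) → Integrable f μ := fun μ _ f hf D hD =>
    Integrable.of_bound hf.aestronglyMeasurable D (Filter.Eventually.of_forall hD)
  -- Moving the negative parts across turns the hypothesis into one on positive finite measures.
  have E : mapPosPart ν ψ h + mapPosPart ν' ψ' (fun x => -h' x)
      = mapPosPart ν ψ (fun x => -h x) + mapPosPart ν' ψ' h' := by
    have : IsFiniteMeasure (mapPosPart ν' ψ' fun x => -h' x) := ‹_›
    have : IsFiniteMeasure (mapPosPart ν ψ fun x => -h x) := ‹_›
    refine Measure.ext_of_charFun (funext fun t => ?_)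
    have hb : ∀ v, ‖expInner t v‖ ≤ 1 := fun v => (norm_expInner t v).le
    have hc := (continuous_expInner t).measurable
    have Ht := H t
    rw [integral_comp_mul_ofReal hψ hm hh hc hb, integral_comp_mul_ofReal hψ' hm' hh' hc hb] at Ht
    simp only [charFun_apply]
    change ∫ v, expInner t v ∂_ = ∫ v, expInner t v ∂_
    rw [integral_add_measure (hint _ hc 1 hb) (hint _ hc 1 hb),
      integral_add_measure (hint _ hc 1 hb) (hint _ hc 1 hb)]
    linear_combination Ht
  have : IsFiniteMeasure (mapPosPart ν' ψ' fun x => -h' x) := ‹_›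
  have : IsFiniteMeasure (mapPosPart ν ψ fun x => -h x) := ‹_›
  have E' := congrArg (fun μ => ∫ v, m v ∂μ) E
  rw [integral_add_measure (hint _ hmm C hC) (hint _ hmm C hC),
      integral_add_measure (hint _ hmm C hC) (hint _ hmm C hC)] at E'
  rw [integral_comp_mul_ofReal hψ hm hh hmm hC, integral_comp_mul_ofReal hψ' hm' hh' hmm hC]
  linear_combination E'

/-- If the images under `ψ` and `ψ'` of the complex measures `h ν` and `h' ν'` have the same
Fourier transform, they are equal. -/
theorem integral_comp_mul_eq (hψ : Measurable ψ) (hψ' : Measurable ψ') {h : X → ℂ}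
    {h' : X' → ℂ} (hm : Measurable h) (hm' : Measurable h') (hh : Integrable h ν)
    (hh' : Integrable h' ν')
    (H : ∀ t, ∫ x, expInner t (ψ x) * h x ∂ν = ∫ x, expInner t (ψ' x) * h' x ∂ν')
    {m : V → ℂ} (hmm : Measurable m) {C : ℝ} (hC : ∀ v, ‖m v‖ ≤ C) :
    ∫ x, m (ψ x) * h x ∂ν = ∫ x, m (ψ' x) * h' x ∂ν' := by
  -- The hypothesis passes to the complex conjugate densities, hence to real and imaginary parts.
  have Hc : ∀ t, ∫ x, expInner t (ψ x) * starRingEnd ℂ (h x) ∂ν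
      = ∫ x, expInner t (ψ' x) * starRingEnd ℂ (h' x) ∂ν' := by
    intro t
    have := congrArg (starRingEnd ℂ) (H (-t))
    rw [← integral_conj, ← integral_conj] at this
    simpa only [map_mul, conj_expInner, neg_neg] using this
  have hcj : Integrable (fun x => starRingEnd ℂ (h x)) ν :=
    (LinearIsometryEquiv.integrable_comp_iff Complex.conjLIE).2 hh
  have hcj' : Integrable (fun x => starRingEnd ℂ (h' x)) ν' :=
    (LinearIsometryEquiv.integrable_comp_iff Complex.conjLIE).2 hh'
  have Hre : ∀ t, ∫ x, expInner t (ψ x) * ((h x).re : ℂ) ∂ν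
      = ∫ x, expInner t (ψ' x) * ((h' x).re : ℂ) ∂ν' := by
    intro t
    have e : ∀ a z : ℂ, a * (z.re : ℂ) = (a * z + a * starRingEnd ℂ z) * (1 / 2) := by
      intro a z; rw [Complex.re_eq_add_conj]; ring
    simp only [e]
    rw [integral_mul_const, integral_mul_const,
      integral_add (integrable_expInner_mul hψ hh t) (integrable_expInner_mul hψ hcj t),
      integral_add (integrable_expInner_mul hψ' hh' t) (integrable_expInner_mul hψ' hcj' t), H, Hc]
  have Him : ∀ t, ∫ x, expInner t (ψ x) * ((h x).im : ℂ) ∂ν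
      = ∫ x, expInner t (ψ' x) * ((h' x).im : ℂ) ∂ν' := by
    intro t
    have e : ∀ a z : ℂ, a * (z.im : ℂ) = (a * z - a * starRingEnd ℂ z) * (1 / (2 * Complex.I)) := by
      intro a z; rw [Complex.im_eq_sub_conj]; ring
    simp only [e]
    rw [integral_mul_const, integral_mul_const,
      integral_sub (integrable_expInner_mul hψ hh t) (integrable_expInner_mul hψ hcj t),
      integral_sub (integrable_expInner_mul hψ' hh' t) (integrable_expInner_mul hψ' hcj' t), H, Hc]
  have R := integral_comp_mul_ofReal_eq hψ hψ' (Complex.measurable_re.comp hm)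
    (Complex.measurable_re.comp hm') hh.re hh'.re Hre hmm hC
  have I := integral_comp_mul_ofReal_eq hψ hψ' (Complex.measurable_im.comp hm)
    (Complex.measurable_im.comp hm') hh.im hh'.im Him hmm hC
  rw [integral_comp_mul_re_add_im hψ hh hmm hC, integral_comp_mul_re_add_im hψ' hh' hmm hC]
  exact congrArg₂ (fun a b => a + Complex.I * b) R I

/-- An operator between `L²` spaces that intertwines multiplication by the characters
`exp(i ⟪ψ, t⟫)` and `exp(i ⟪ψ', t⟫)` intertwines multiplication by `m ∘ ψ` and `m ∘ ψ'` for every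
bounded measurable `m`. -/
theorem intertwines_comp (hψ : Measurable ψ) (hψ' : Measurable ψ')
    (T : Lp ℂ 2 ν →L[ℂ] Lp ℂ 2 ν')
    (hT : ∀ (t : V) (F G : Lp ℂ 2 ν), G =ᵐ[ν] (fun x => expInner t (ψ x) * F x) →
      T G =ᵐ[ν'] fun x => expInner t (ψ' x) * T F x)
    {m : V → ℂ} (hm : Measurable m) {C : ℝ} (hC : ∀ v, ‖m v‖ ≤ C) (F G : Lp ℂ 2 ν)
    (hG : G =ᵐ[ν] fun x => m (ψ x) * F x) : T G =ᵐ[ν'] fun x => m (ψ' x) * T F x := by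
  have key : T G = (memLp_comp_mul hψ' (T F) hm hC).toLp := by
    refine ext_inner_left ℂ fun K => ?_
    have i1 : ∀ {m : V → ℂ} (G : Lp ℂ 2 ν), G =ᵐ[ν] (fun x => m (ψ x) * F x) →
        inner ℂ K (T G)
          = ∫ x, m (ψ x) * (F x * starRingEnd ℂ (ContinuousLinearMap.adjoint T K x)) ∂ν := by
      intro m G hG
      rw [← ContinuousLinearMap.adjoint_inner_left, L2.inner_def]
      refine integral_congr_ae ?_
      filter_upwards [hG] with x hx
      rw [hx, RCLike.inner_apply]; ring
    have i2 : ∀ {m : V → ℂ} (G : Lp ℂ 2 ν'), G =ᵐ[ν'] (fun x => m (ψ' x) * T F x) →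
        inner ℂ K G = ∫ x, m (ψ' x) * (T F x * starRingEnd ℂ (K x)) ∂ν' := by
      intro m G hG
      rw [L2.inner_def]
      refine integral_congr_ae ?_
      filter_upwards [hG] with x hx
      rw [hx, RCLike.inner_apply]; ring
    rw [i1 G hG, i2 _ (MemLp.coeFn_toLp _)]
    refine integral_comp_mul_eq hψ hψ' ?_ ?_ ?_ ?_ (fun t => ?_) hm hC
    · exact (Lp.stronglyMeasurable _).measurable.mul
        (Complex.continuous_conj.measurable.comp (Lp.stronglyMeasurable _).measurable)
    · exact (Lp.stronglyMeasurable _).measurable.mul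
        (Complex.continuous_conj.measurable.comp (Lp.stronglyMeasurable _).measurable)
    · simpa only [RCLike.inner_apply] using
        L2.integrable_inner (𝕜 := ℂ) (ContinuousLinearMap.adjoint T K) F
    · simpa only [RCLike.inner_apply] using L2.integrable_inner (𝕜 := ℂ) K (T F)
    · have hF := MemLp.coeFn_toLp (memLp_comp_mul hψ F (continuous_expInner t).measurable
        fun v => (norm_expInner t v).le)
      rw [← i1 _ hF, i2 _ (hT t F _ hF)]
  rw [key]
  exact MemLp.coeFn_toLp _

end Fourier

/-! ### Coordinates on the nondegenerate orbits -/

/-- Coordinates of the skew-Hermitian matrix `s* ξ s`, for `ξ = diag(±i, ±i)` with signs `k`: the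
imaginary parts of the two diagonal entries, and twice the real and imaginary parts of the lower
left entry. The factor two makes the pairing `Re tr(η n*)` a standard inner product. -/
noncomputable def orbitCoord (k : ℤˣ × ℤˣ) (s : S) : EuclideanSpace ℝ (Fin 4) :=
  !₂[((k.1 : ℤ) : ℝ) * (mat s 0 0).re ^ 2
      + ((k.2 : ℤ) : ℝ) * ((mat s 1 0).re ^ 2 + (mat s 1 0).im ^ 2),
    ((k.2 : ℤ) : ℝ) * (mat s 1 1).re ^ 2,
    -2 * ((k.2 : ℤ) : ℝ) * (mat s 1 1).re * (mat s 1 0).im,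
    2 * ((k.2 : ℤ) : ℝ) * (mat s 1 1).re * (mat s 1 0).re]

theorem continuous_orbitCoord (k : ℤˣ × ℤˣ) : Continuous (orbitCoord k) := by
  have h : ∀ i j, Continuous fun s : S => mat s i j := fun i j => continuous_mat.matrix_elem i j
  have hr : ∀ i j, Continuous fun s : S => (mat s i j).re := fun i j =>
    Complex.continuous_re.comp (h i j)
  have hi : ∀ i j, Continuous fun s : S => (mat s i j).im := fun i j =>
    Complex.continuous_im.comp (h i j)
  refine (PiLp.continuous_toLp 2 _).comp (continuous_pi fun i => ?_)
  have := hr 0 0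
  have := hr 1 1
  have := hr 1 0
  have := hi 1 0
  fin_cases i <;> simp <;> fun_prop

/-- The skew-Hermitian matrix with given coordinates: the imaginary parts of the two diagonal
entries, and the real and imaginary parts of the lower left entry. -/
def skewOf (t : EuclideanSpace ℝ (Fin 4)) : SkewHerm :=
  ⟨!![(t 0 : ℂ) * Complex.I, -(t 2 : ℂ) + (t 3 : ℂ) * Complex.I;
      (t 2 : ℂ) + (t 3 : ℂ) * Complex.I, (t 1 : ℂ) * Complex.I], by
    rw [skewAdjoint.mem_iff]
    ext i j
    fin_cases i <;> fin_cases j <;> simp [Matrix.star_apply, add_comm]⟩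

theorem ev_charOf_act_skewOf (k : ℤˣ × ℤˣ) (s : S) (t : EuclideanSpace ℝ (Fin 4)) :
    ev (charOf (diagMat k)) (act s (skewOf t)) = expInner t (orbitCoord k s) := by
  obtain ⟨r₁, r₂, r, h₁, h₂, h⟩ := s.2
  have hs : mat s = !![(r₁ : ℂ), 0; r, (r₂ : ℂ)] := h
  change ((Circle.exp (diagMat k * ((mat s) * (skewOf t : M2) * (mat s)ᴴ)ᴴ).trace.re : Circle) : ℂ)
    = _
  rw [Circle.coe_exp, expInner]
  congr 3
  simp only [orbitCoord, hs, skewOf, diagMat, PiLp.inner_apply, Fin.sum_univ_four,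
    Matrix.trace_fin_two, Matrix.mul_apply, Fin.sum_univ_two, conjTranspose_apply]
  simp
  ring

/-- The four orbits are disjoint and `S` acts freely on each of them. -/
theorem orbitCoord_inj {k k' : ℤˣ × ℤˣ} {s s' : S} (h : orbitCoord k s = orbitCoord k' s') :
    k = k' ∧ s = s' := by
  obtain ⟨a, b, r, ha, hb, hs⟩ := s.2
  obtain ⟨a', b', r', ha', hb', hs'⟩ := s'.2
  have e : mat s = !![(a : ℂ), 0; r, (b : ℂ)] := hs
  have e' : mat s' = !![(a' : ℂ), 0; r', (b' : ℂ)] := hs'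
  have h0 := congrFun (congrArg WithLp.ofLp h) 0
  have h1 := congrFun (congrArg WithLp.ofLp h) 1
  have h2 := congrFun (congrArg WithLp.ofLp h) 2
  have h3 := congrFun (congrArg WithLp.ofLp h) 3
  simp [orbitCoord, e, e'] at h0 h1 h2 h3
  have sign : ∀ {ε ε' : ℤˣ} {x y : ℝ}, 0 < x → 0 < y →
      ((ε : ℤ) : ℝ) * x ^ 2 = ((ε' : ℤ) : ℝ) * y ^ 2 → ε = ε' ∧ x = y := by
    intro ε ε' x y hx hy hxy
    have hx2 : 0 < x ^ 2 := by positivity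
    have hy2 : 0 < y ^ 2 := by positivity
    rcases Int.units_eq_one_or ε with rfl | rfl <;> rcases Int.units_eq_one_or ε' with rfl | rfl
    · simpa [pow_left_inj₀ hx.le hy.le] using hxy
    · simp at hxy; linarith
    · simp at hxy; linarith
    · simpa [pow_left_inj₀ hx.le hy.le] using hxy
  obtain ⟨hk2, rfl⟩ := sign hb hb' h1
  obtain ⟨k1, k2⟩ := k
  obtain ⟨k1', k2'⟩ := k'
  simp only at hk2 h0 h1 h2 h3
  subst hk2
  have hk2 : ((k2 : ℤ) : ℝ) ≠ 0 := by exact_mod_cast k2.ne_zero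
  have him : r.im = r'.im := by simpa [hk2, hb.ne'] using h2
  have hre : r.re = r'.re := by simpa [hk2, hb.ne'] using h3
  obtain rfl : r = r' := Complex.ext hre him
  obtain ⟨rfl, rfl⟩ := sign ha ha' (by simpa using h0)
  exact ⟨rfl, Subtype.ext (Units.ext (hs.trans hs'.symm))⟩

/-- As functions of `s`, the multipliers by which `N` acts are the characters `exp(i ⟪·, t⟫)` of
`ℝ⁴` composed with the orbit map `s ↦ orbitCoord k (u * s)`. -/
theorem ev_act_skewOf {k : ℤˣ × ℤˣ} {χ : NHat} {u : S} (hu : charAct (charOf (diagMat k)) u = χ)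
    (s : S) (t : EuclideanSpace ℝ (Fin 4)) :
    ev χ (act s (skewOf t)) = expInner t (orbitCoord k (u * s)) := by
  rw [← hu, ev_charAct, ← act_mul, ev_charOf_act_skewOf]

theorem continuous_orbitCoord_mul (k : ℤˣ × ℤˣ) (u : S) :
    Continuous fun s => orbitCoord k (u * s) :=
  (continuous_orbitCoord k).comp (continuous_const_mul u)

theorem measurableEmbedding_orbitCoord_mul (k : ℤˣ × ℤˣ) (u : S) :
    MeasurableEmbedding fun s => orbitCoord k (u * s) :=
  (continuous_orbitCoord_mul k u).measurableEmbedding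
    fun _ _ h => mul_left_cancel (orbitCoord_inj h).2

/-! ### Operators intertwining the action of `N` -/

section Intertwining

variable {k k' : ℤˣ × ℤˣ} {χ χ' : NHat} {ν ν' : Measure S}

theorem intertwines_orbitCoord {u u' : S} (hu : charAct (charOf (diagMat k)) u = χ)
    (hu' : charAct (charOf (diagMat k')) u' = χ') (hν : IsAlmostInvariant ν)
    (hν' : IsAlmostInvariant ν') (T : Lp ℂ 2 ν →L[ℂ] Lp ℂ 2 ν')
    (hT : ∀ n F, T (rep χ hν (P.ofN n) F) = rep χ' hν' (P.ofN n) (T F))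
    {m : EuclideanSpace ℝ (Fin 4) → ℂ} (hm : Measurable m) {C : ℝ} (hC : ∀ v, ‖m v‖ ≤ C)
    (F G : Lp ℂ 2 ν) (hG : G =ᵐ[ν] fun s => m (orbitCoord k (u * s)) * F s) :
    T G =ᵐ[ν'] fun s => m (orbitCoord k' (u' * s)) * T F s := by
  refine intertwines_comp (measurableEmbedding_orbitCoord_mul k u).measurable
    (measurableEmbedding_orbitCoord_mul k' u').measurable T (fun t F G hG => ?_) hm hC F G hG
  have e : G = rep χ hν (P.ofN (skewOf t)) F := by
    refine Lp.ext (hG.trans (Filter.EventuallyEq.symm ((rep_ofN χ hν _ F).trans ?_)))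
    exact Filter.Eventually.of_forall fun s => by simp only [ev_act_skewOf hu]
  rw [e, hT]
  refine (rep_ofN χ' hν' _ _).trans (Filter.Eventually.of_forall fun s => ?_)
  simp only [ev_act_skewOf hu']

/-- For different indices the orbits are disjoint, so that multiplication by the indicator of one
orbit is intertwined with zero. -/
theorem eq_zero_of_intertwines_ofN (hχ : χ ∈ charOrbit k) (hχ' : χ' ∈ charOrbit k') (hk : k ≠ k')
    (hν : IsAlmostInvariant ν) (hν' : IsAlmostInvariant ν') (T : Lp ℂ 2 ν →L[ℂ] Lp ℂ 2 ν')
    (hT : ∀ n F, T (rep χ hν (P.ofN n) F) = rep χ' hν' (P.ofN n) (T F)) : T = 0 := by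
  obtain ⟨u, hu⟩ := hχ
  obtain ⟨u', hu'⟩ := hχ'
  ext1 F
  have hB := (measurableEmbedding_orbitCoord_mul k u).measurableSet_range
  have h := intertwines_orbitCoord hu hu' hν hν' T hT (C := 1)
    ((measurable_const (a := (1 : ℂ))).indicator hB) (fun v => ?_) F F
    (Filter.Eventually.of_forall fun s => by simp)
  · refine Lp.ext (h.trans (Filter.EventuallyEq.symm ((Lp.coeFn_zero _ _ _).trans ?_)))
    refine Filter.Eventually.of_forall fun s => ?_
    simp only [Pi.zero_apply]
    rw [Set.indicator_of_notMem, zero_mul]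
    · rintro ⟨s', hs'⟩
      exact hk (orbitCoord_inj hs').1
  · exact (norm_indicator_le_norm_self _ v).trans (by simp)

/-- For equal indices, every bounded measurable function on `S` factors through the orbit. -/
theorem intertwines_mul (hχ : χ ∈ charOrbit k) (hν : IsAlmostInvariant ν)
    (hν' : IsAlmostInvariant ν') (T : Lp ℂ 2 ν →L[ℂ] Lp ℂ 2 ν')
    (hT : ∀ n F, T (rep χ hν (P.ofN n) F) = rep χ hν' (P.ofN n) (T F))
    {m : S → ℂ} (hm : Measurable m) {C : ℝ} (hC : ∀ s, ‖m s‖ ≤ C)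
    {F G : Lp ℂ 2 ν} (hG : G =ᵐ[ν] fun s => m s * F s) : T G =ᵐ[ν'] fun s => m s * T F s := by
  obtain ⟨u, hu⟩ := hχ
  have he := measurableEmbedding_orbitCoord_mul k u
  have hext : ∀ s,
      Function.extend (fun s => orbitCoord k (u * s)) m 0 (orbitCoord k (u * s)) = m s := fun s =>
    he.injective.extend_apply m 0 s
  have h := intertwines_orbitCoord hu hu hν hν' T hT (C := C)
    (he.measurable_extend hm measurable_zero) (fun v => ?_) F G (by simpa only [hext] using hG)
  · simpa only [hext] using h
  · by_cases hv : ∃ s, orbitCoord k (u * s) = v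
    · obtain ⟨s, rfl⟩ := hv
      rw [hext]; exact hC s
    · rw [Function.extend_apply' _ _ _ hv]
      simpa using (norm_nonneg _).trans (hC 1)

/-- A square integrable function that vanishes nowhere. -/
theorem exists_memLp_pos {X : Type*} [MeasurableSpace X] (ν : Measure X) [SigmaFinite ν] :
    ∃ f : X → ℝ, (∀ x, 0 < f x) ∧ Measurable f ∧ MemLp (fun x => (f x : ℂ)) 2 ν := by
  obtain ⟨g, hg, hgm, hgi⟩ := exists_pos_lintegral_lt_of_sigmaFinite ν one_ne_zero
  have hm : Measurable fun x => √(g x : ℝ) := hgm.coe_nnreal_real.sqrt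
  refine ⟨fun x => √(g x), fun x => Real.sqrt_pos.2 (hg x), hm, ?_⟩
  refine ⟨(Complex.measurable_ofReal.comp hm).aestronglyMeasurable, ?_⟩
  rw [eLpNorm_lt_top_iff_lintegral_rpow_enorm_lt_top (by norm_num) (by norm_num)]
  refine lt_of_le_of_lt (lintegral_mono fun x => ?_) (hgi.trans ENNReal.one_lt_top)
  have : ‖((√(g x : ℝ) : ℝ) : ℂ)‖ₑ = ((NNReal.sqrt (g x) : ℝ≥0) : ℝ≥0∞) := by
    rw [enorm_eq_nnnorm]
    congr 1
    ext
    simp [abs_of_nonneg]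
  rw [this]
  simp only [ENNReal.toReal_ofNat, ENNReal.rpow_ofNat]
  rw [← ENNReal.coe_pow, NNReal.sq_sqrt]

/-- An operator intertwining the action of `N` for equal indices is a multiplication. With `f₀`
nowhere zero, the multiplier is `φ = T f₀ / f₀`; for general `F`, both `F` and `f₀` are bounded
multiples of `|F| + f₀`, which gives `f₀ T F = F T f₀`. -/
theorem exists_eq_mul (hχ : χ ∈ charOrbit k) (hν : IsAlmostInvariant ν)
    (hν' : IsAlmostInvariant ν') (T : Lp ℂ 2 ν →L[ℂ] Lp ℂ 2 ν')
    (hT : ∀ n F, T (rep χ hν (P.ofN n) F) = rep χ hν' (P.ofN n) (T F)) :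
    ∃ φ : S → ℂ, Measurable φ ∧ ∀ F : Lp ℂ 2 ν, T F =ᵐ[ν'] fun s => φ s * F s := by
  have := hν.sigmaFinite
  obtain ⟨f, hf, hfm, hfL⟩ := exists_memLp_pos ν
  set F₀ : Lp ℂ 2 ν := hfL.toLp with hF₀
  have hfc : ∀ s, (f s : ℂ) ≠ 0 := fun s => by exact_mod_cast (hf s).ne'
  refine ⟨fun s => T F₀ s / f s,
    (Lp.stronglyMeasurable _).measurable.div (Complex.measurable_ofReal.comp hfm), fun F => ?_⟩
  have hFm : Measurable F := (Lp.stronglyMeasurable F).measurable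
  set g : S → ℝ := fun s => ‖F s‖ + f s with hgdef
  have hg : ∀ s, 0 < g s := fun s => add_pos_of_nonneg_of_pos (norm_nonneg _) (hf s)
  have hgc : ∀ s, (g s : ℂ) ≠ 0 := fun s => by exact_mod_cast (hg s).ne'
  have hgm : Measurable fun s => (g s : ℂ) := Complex.measurable_ofReal.comp (hFm.norm.add hfm)
  have hgL : MemLp (fun s => (g s : ℂ)) 2 ν := by
    have h : MemLp (fun s => ((‖F s‖ : ℝ) : ℂ)) 2 ν := (Lp.memLp F).norm.ofReal
    refine (h.add hfL).ae_eq (Filter.Eventually.of_forall fun s => ?_)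
    simp [hgdef]
  have hG := MemLp.coeFn_toLp hgL
  have h1 := intertwines_mul hχ hν hν' T hT (m := fun s => F s / g s) (hFm.div hgm) (C := 1)
    (fun s => by
      rw [norm_div, Complex.norm_real, Real.norm_of_nonneg (hg s).le, div_le_one (hg s)]
      exact le_add_of_nonneg_right (hf s).le) (F := hgL.toLp) (G := F) (by
      filter_upwards [hG] with s hs
      rw [hs, div_mul_cancel₀ _ (hgc s)])
  have h2 := intertwines_mul hχ hν hν' T hT (m := fun s => (f s : ℂ) / g s)
    ((Complex.measurable_ofReal.comp hfm).div hgm) (C := 1)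
    (fun s => by
      rw [norm_div, Complex.norm_real, Complex.norm_real, Real.norm_of_nonneg (hg s).le,
        Real.norm_of_nonneg (hf s).le, div_le_one (hg s)]
      exact le_add_of_nonneg_left (norm_nonneg _)) (F := hgL.toLp) (G := F₀) (by
      filter_upwards [hG, MemLp.coeFn_toLp hfL] with s hs hs'
      rw [hs, hs', div_mul_cancel₀ _ (hgc s)])
  filter_upwards [h1, h2] with s hs hs'
  rw [hs, hs']
  field_simp [hfc s, hgc s]

/-- An operator intertwining the representations of `P` for equal indices is multiplication by a
constant. -/
theorem exists_eq_const_mul (hχ : χ ∈ charOrbit k) (hν : IsAlmostInvariant ν)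
    (hν' : IsAlmostInvariant ν') (hac : ν' ≪ ν) (T : Lp ℂ 2 ν →L[ℂ] Lp ℂ 2 ν')
    (hT : ∀ n F, T (rep χ hν (P.ofN n) F) = rep χ hν' (P.ofN n) (T F))
    (hTS : ∀ s F, T (rep χ hν (P.ofS s) F) = rep χ hν' (P.ofS s) (T F)) :
    ∃ c : ℂ, ∀ F : Lp ℂ 2 ν, T F =ᵐ[ν'] fun s => c * F s := by
  have := hν.sigmaFinite
  have := hν'.sigmaFinite
  obtain ⟨φ, hφ, hTφ⟩ := exists_eq_mul hχ hν hν' T hT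
  obtain ⟨f, hf, hfm, hfL⟩ := exists_memLp_pos ν
  have hfc : ∀ s, (f s : ℂ) ≠ 0 := fun s => by exact_mod_cast (hf s).ne'
  have hF := MemLp.coeFn_toLp hfL
  have hne : ν' ≠ 0 := by
    intro h
    simpa [h] using hν'.infinite
  have hinv : ∀ t : S, ∀ᵐ s ∂ν', φ (s * t) = φ s := by
    intro t
    have hmap : ∀ {p : S → Prop}, (∀ᵐ s ∂ν', p s) → ∀ᵐ s ∂ν', p (s * t) := fun hp =>
      ae_of_ae_map (measurable_mul_right t).aemeasurable ((hν'.map_absCont t).ae_le hp)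
    have h1 := hTφ (rep χ hν (P.ofS t) hfL.toLp)
    rw [hTS] at h1
    filter_upwards [h1, rep_ofS χ hν' t (T hfL.toLp), hac.ae_le (rep_ofS χ hν t hfL.toLp),
      hmap (hTφ hfL.toLp), hmap (hac.ae_le hF)] with s e1 e2 e3 e4 e5
    rw [e2, e3, e4, e5] at e1
    exact mul_right_cancel₀ (hfc _) e1
  obtain ⟨c, hc⟩ := exists_ae_eq_const hν'.absCont hne hφ hinv
  refine ⟨c, fun F => ?_⟩
  filter_upwards [hTφ F, hc] with s h1 h2
  rw [h1, h2]

end Intertwining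

/-! ### Irreducibility -/

section Irreducible

variable {k : ℤˣ × ℤˣ} {χ : NHat} {ν : Measure S}

theorem nontrivial_Lp (hν : IsAlmostInvariant ν) : Nontrivial (Lp ℂ 2 ν) := by
  have := hν.sigmaFinite
  obtain ⟨f, hf, -, hfL⟩ := exists_memLp_pos ν
  have hfc : ∀ s, (f s : ℂ) ≠ 0 := fun s => by exact_mod_cast (hf s).ne'
  refine ⟨hfL.toLp, 0, fun h => ?_⟩
  have h1 : ∀ᵐ s ∂ν, False := by
    filter_upwards [MemLp.coeFn_toLp hfL, Lp.coeFn_zero ℂ 2 ν] with s h1 h2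
    rw [h, h2] at h1
    exact hfc s (by simpa using h1.symm)
  have h2 : ν = 0 := by simpa using h1
  simpa [h2] using hν.infinite

theorem operatorIrreducible_rep (hχ : χ ∈ charOrbit k) (hν : IsAlmostInvariant ν) :
    OperatorIrreducible (rep χ hν) := by
  refine ⟨nontrivial_Lp hν, fun A hA => ?_⟩
  have hA' : ∀ g F, A (rep χ hν g F) = rep χ hν g (A F) := fun g F =>
    congrArg (fun B : Lp ℂ 2 ν →L[ℂ] Lp ℂ 2 ν => B F) (hA g)
  obtain ⟨c, hc⟩ := exists_eq_const_mul hχ hν hν Measure.AbsolutelyContinuous.rfl A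
    (fun n => hA' _) (fun s => hA' _)
  refine ⟨c, ?_⟩
  ext1 F
  refine Lp.ext ((hc F).trans (Filter.EventuallyEq.symm ((Lp.coeFn_smul c F).trans ?_)))
  exact Filter.Eventually.of_forall fun s => rfl

theorem spaceIrreducible_rep (hχ : χ ∈ charOrbit k) (hν : IsAlmostInvariant ν) :
    SpaceIrreducible (rep χ hν) := by
  refine ⟨nontrivial_Lp hν, fun M hM hinv => ?_⟩
  have := hM.completeSpace_coe
  have hσ := hν.sigmaFinite
  -- The group `N` acts by unitary operators, so the orthogonal projection commutes with it.
  have hadj : ∀ n (F G : Lp ℂ 2 ν),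
      inner ℂ F (rep χ hν (P.ofN n) G) = inner ℂ (rep χ hν (P.ofN (-n)) F) G := by
    intro n F G
    rw [L2.inner_def, L2.inner_def]
    refine integral_congr_ae ?_
    filter_upwards [rep_ofN χ hν n G, rep_ofN χ hν (-n) F] with s h1 h2
    have h3 : act s (-n) = -act s n := Subtype.ext (by simp [act])
    have h4 : starRingEnd ℂ (ev χ (-act s n)) = ev χ (act s n) := by
      rw [ev, ofAdd_neg, map_inv, Circle.coe_inv_eq_conj, Complex.conj_conj, ev]
    rw [h1, h2, h3, RCLike.inner_apply, RCLike.inner_apply, map_mul, h4]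
    ring
  have hcomm : ∀ n F, M.starProjection (rep χ hν (P.ofN n) F)
      = rep χ hν (P.ofN n) (M.starProjection F) := by
    intro n F
    refine (Submodule.eq_starProjection_of_mem_of_inner_eq_zero
      (hinv _ _ (M.starProjection_apply_mem F)) fun w hw => ?_)
    rw [← map_sub, ← inner_conj_symm, hadj, inner_conj_symm]
    exact M.starProjection_inner_eq_zero F _ (hinv _ _ hw)
  obtain ⟨φ, hφ, hTφ⟩ := exists_eq_mul hχ hν hν M.starProjection hcomm
  obtain ⟨f, hf, hfm, hfL⟩ := exists_memLp_pos ν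
  have hfc : ∀ s, (f s : ℂ) ≠ 0 := fun s => by exact_mod_cast (hf s).ne'
  have hF := MemLp.coeFn_toLp hfL
  have hmap : ∀ (t : S) {p : S → Prop}, (∀ᵐ s ∂ν, p s) → ∀ᵐ s ∂ν, p (s * t) := fun t p hp =>
    ae_of_ae_map (measurable_mul_right t).aemeasurable ((hν.map_absCont t).ae_le hp)
  -- Invariance of the range of the projection under `t` gives one relation, invariance under `t⁻¹`
  -- the symmetric one, and together they say that the multiplier is invariant.
  have h1 : ∀ t : S, ∀ᵐ s ∂ν, φ s * φ (s * t) = φ (s * t) := by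
    intro t
    have hmem := hinv (P.ofS t) _ (M.starProjection_apply_mem hfL.toLp)
    have e := hTφ (rep χ hν (P.ofS t) (M.starProjection hfL.toLp))
    rw [Submodule.starProjection_eq_self_iff.2 hmem] at e
    filter_upwards [e, rep_ofS χ hν t (M.starProjection hfL.toLp), hmap t (hTφ hfL.toLp),
      hmap t hF] with s e1 e2 e3 e4
    rw [e2, e3, e4, ← mul_assoc] at e1
    exact (mul_right_cancel₀ (hfc _) e1).symm
  have h2 : ∀ t : S, ∀ᵐ s ∂ν, φ (s * t) = φ s := by
    intro t
    filter_upwards [h1 t, hmap t (h1 t⁻¹)] with s e1 e2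
    rw [mul_inv_cancel_right] at e2
    rw [← e1, mul_comm, e2]
  have hne : ν ≠ 0 := by
    intro h
    simpa [h] using hν.infinite
  obtain ⟨c, hc⟩ := exists_ae_eq_const hν.absCont hne hφ h2
  have hproj : ∀ F, M.starProjection F = c • F := by
    intro F
    refine Lp.ext ?_
    filter_upwards [hTφ F, hc, Lp.coeFn_smul c F] with s e1 e2 e3
    rw [e1, e2, e3]; rfl
  by_cases h0 : c = 0
  · left
    refine (Submodule.eq_bot_iff _).2 fun F hF => ?_
    rw [← Submodule.starProjection_eq_self_iff.2 hF, hproj, h0, zero_smul]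
  · right
    refine Submodule.eq_top_iff'.2 fun F => ?_
    have := M.smul_mem c⁻¹ (M.starProjection_apply_mem F)
    rwa [hproj, smul_smul, inv_mul_cancel₀ h0, one_smul] at this

end Irreducible

/-! ### Unitary equivalence -/

section Equivalence

variable {k k' : ℤˣ × ℤˣ} {χ χ' : NHat} {ν ν' : Measure S}

/-- Multiplication by the indicator of a `ν`-null set is zero on `L²(ν)`, hence it is also zero on
`L²(ν')`, the range of `T`. -/
theorem absolutelyContinuous_of_surjective (hχ : χ ∈ charOrbit k) (hν : IsAlmostInvariant ν)
    (hν' : IsAlmostInvariant ν') (T : Lp ℂ 2 ν →L[ℂ] Lp ℂ 2 ν')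
    (hT : ∀ n F, T (rep χ hν (P.ofN n) F) = rep χ hν' (P.ofN n) (T F))
    (hsurj : Function.Surjective T) : ν' ≪ ν := by
  have := hν'.sigmaFinite
  refine Measure.AbsolutelyContinuous.mk fun A hA hA0 => ?_
  obtain ⟨f, hf, hfm, hfL⟩ := exists_memLp_pos ν'
  obtain ⟨F, hF⟩ := hsurj hfL.toLp
  have h := intertwines_mul hχ hν hν' T hT (m := A.indicator fun _ => (1 : ℂ))
    (measurable_const.indicator hA) (C := 1)
    (fun s => (norm_indicator_le_norm_self _ s).trans (by simp)) (F := F) (G := 0) (by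
      have hA' : ∀ᵐ s ∂ν, s ∉ A := measure_eq_zero_iff_ae_notMem.1 hA0
      filter_upwards [hA', Lp.coeFn_zero ℂ 2 ν] with s h1 h2
      rw [h2]
      simp [h1])
  rw [map_zero, hF] at h
  rw [measure_eq_zero_iff_ae_notMem]
  filter_upwards [h, Lp.coeFn_zero ℂ 2 ν', MemLp.coeFn_toLp hfL] with s h1 h2 h3 hs
  rw [h2, h3] at h1
  simp [hs] at h1
  exact (hf s).ne (by exact_mod_cast h1)

theorem exists_eq_smul_of_unitarilyEquivalent (hχ : χ ∈ charOrbit k) (hν : IsAlmostInvariant ν)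
    (hν' : IsAlmostInvariant ν') (h : UnitarilyEquivalent (rep χ hν) (rep χ hν')) :
    ∃ c : ℝ≥0, 0 < c ∧ ν' = c • ν := by
  obtain ⟨U, hU⟩ := h
  have := hν.sigmaFinite
  set T : Lp ℂ 2 ν →L[ℂ] Lp ℂ 2 ν' := U.toContinuousLinearEquiv.toContinuousLinearMap with hTdef
  have hT : ∀ g F, T (rep χ hν g F) = rep χ hν' g (T F) := hU
  have hac := absolutelyContinuous_of_surjective hχ hν hν' T (fun n => hT _) U.surjective
  obtain ⟨c, hc⟩ := exists_eq_const_mul hχ hν hν' hac T (fun n => hT _) (fun s => hT _)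
  -- Compare norms of indicators of sets of finite measure.
  have hfin : ∀ A, MeasurableSet A → ν A ≠ ∞ → ν A = ((‖c‖₊ ^ 2 : ℝ≥0) : ℝ≥0∞) * ν' A := by
    intro A hA hAf
    have hL : MemLp (A.indicator fun _ => (1 : ℂ)) 2 ν := memLp_indicator_const 2 hA 1 (Or.inr hAf)
    have e1 : eLpNorm (T hL.toLp) 2 ν' = eLpNorm hL.toLp 2 ν := by
      have hn : ‖T hL.toLp‖ₑ = ‖hL.toLp‖ₑ := by
        simp only [enorm_eq_nnnorm]
        congr 1
        exact U.nnnorm_map _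
      simpa only [Lp.enorm_def] using hn
    have e2 : eLpNorm (T hL.toLp) 2 ν' = eLpNorm (A.indicator fun _ => c) 2 ν' := by
      refine eLpNorm_congr_ae ?_
      filter_upwards [hc hL.toLp, hac.ae_le (MemLp.coeFn_toLp hL)] with s h1 h2
      rw [h1, h2]
      by_cases hs : s ∈ A <;> simp [hs]
    rw [e2, eLpNorm_congr_ae (MemLp.coeFn_toLp hL),
      eLpNorm_indicator_const hA (by norm_num) (by norm_num),
      eLpNorm_indicator_const hA (by norm_num) (by norm_num)] at e1
    have e3 := congrArg (fun x : ℝ≥0∞ => x ^ (2 : ℝ)) e1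
    simp only [ENNReal.mul_rpow_of_nonneg _ _ (zero_le_two : (0 : ℝ) ≤ 2), ← ENNReal.rpow_mul]
      at e3
    simpa [enorm_eq_nnnorm] using e3.symm
  have hall : ν = (‖c‖₊ ^ 2 : ℝ≥0) • ν' := by
    refine Measure.ext fun A hA => ?_
    have hu : A = ⋃ i, A ∩ spanningSets ν i := by
      rw [← Set.inter_iUnion, iUnion_spanningSets, Set.inter_univ]
    have hmono : Monotone fun i => A ∩ spanningSets ν i := fun i j hij =>
      Set.inter_subset_inter_right _ (monotone_spanningSets ν hij)
    rw [hu, hmono.measure_iUnion, hmono.measure_iUnion]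
    refine iSup_congr fun i => ?_
    rw [hfin _ (hA.inter (measurableSet_spanningSets ν i))
      ((measure_mono Set.inter_subset_right).trans_lt (measure_spanningSets_lt_top ν i)).ne]
    rfl
  have hc0 : ‖c‖₊ ^ 2 ≠ 0 := by
    intro h0
    rw [h0, zero_smul] at hall
    simpa [hall] using hν.infinite
  refine ⟨(‖c‖₊ ^ 2)⁻¹, by positivity, ?_⟩
  conv_rhs => rw [hall]
  rw [smul_smul, inv_mul_cancel₀ hc0, one_smul]

theorem rep_coeFn (hν : IsAlmostInvariant ν) (g : P) (F : Lp ℂ 2 ν) :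
    rep χ hν g F =ᵐ[ν] opFun χ (equivQ.symm g).left.toAdd (equivQ.symm g).right F :=
  op_coeFn χ hν _ _ F

theorem memLp_smul_measure_iff {c : ℝ≥0} (hc : 0 < c) {f : S → ℂ} :
    MemLp f 2 (c • ν) ↔ MemLp f 2 ν := by
  have h : ∀ {d : ℝ≥0} {ρ : Measure S}, MemLp f 2 ρ → MemLp f 2 (d • ρ) := fun hf =>
    hf.smul_measure ENNReal.coe_ne_top
  refine ⟨fun hf => ?_, h⟩
  have := h (d := c⁻¹) hf
  rwa [smul_smul, inv_mul_cancel₀ hc.ne', one_smul] at this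

theorem ae_nnreal_smul_measure {c : ℝ≥0} (hc : 0 < c) : ae (c • ν) = ae ν :=
  Measure.ae_ennreal_smul_measure_eq (ENNReal.coe_ne_zero.2 hc.ne') ν

theorem eLpNorm_nnreal_smul_measure (c : ℝ≥0) (f : S → ℂ) :
    eLpNorm f 2 (c • ν) = (NNReal.sqrt c : ℝ≥0∞) * eLpNorm f 2 ν := by
  have h := eLpNorm_smul_measure_of_ne_top (p := 2) (μ := ν) (by norm_num) f (c : ℝ≥0∞)
  rw [NNReal.sqrt_eq_rpow, ENNReal.coe_rpow_of_nonneg _ (by norm_num)]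
  simpa using h

/-- The scaling `F ↦ c^(-1/2) F` is a unitary operator from `L²(ν)` to `L²(c ν)`. -/
theorem unitarilyEquivalent_smul {c : ℝ≥0} (hc : 0 < c) (hν : IsAlmostInvariant ν)
    (hν' : IsAlmostInvariant (c • ν)) : UnitarilyEquivalent (rep χ hν) (rep χ hν') := by
  have hae : ae (c • ν) = ae ν := ae_nnreal_smul_measure hc
  set r : ℝ≥0 := NNReal.sqrt c with hr
  have hr0 : r ≠ 0 := (NNReal.sqrt_pos.2 hc).ne'
  have hrc : ((r : ℝ) : ℂ) ≠ 0 := by exact_mod_cast hr0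
  have hmem : ∀ F : Lp ℂ 2 ν, MemLp (fun s => ((r : ℝ) : ℂ)⁻¹ * F s) 2 (c • ν) := fun F =>
    (memLp_smul_measure_iff hc).2 ((Lp.memLp F).const_mul _)
  have hcoe : ∀ F, (hmem F).toLp =ᵐ[ν] fun s => ((r : ℝ) : ℂ)⁻¹ * F s := fun F => by
    have := MemLp.coeFn_toLp (hmem F)
    rwa [Filter.EventuallyEq, hae] at this
  have hext : ∀ {F G : Lp ℂ 2 (c • ν)}, F =ᵐ[ν] G → F = G := fun h => by
    rw [Filter.EventuallyEq, ← hae] at h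
    exact Lp.ext h
  have hcoe' : ∀ {F G : S → ℂ}, F =ᵐ[c • ν] G → F =ᵐ[ν] G := fun h => by
    rwa [Filter.EventuallyEq, hae] at h
  let L : Lp ℂ 2 ν →ₗ[ℂ] Lp ℂ 2 (c • ν) :=
    { toFun := fun F => (hmem F).toLp
      map_add' := fun F G => by
        refine hext ?_
        filter_upwards [hcoe (F + G), hcoe F, hcoe G, Lp.coeFn_add F G,
          hcoe' (Lp.coeFn_add (hmem F).toLp (hmem G).toLp)] with s e1 e2 e3 e4 e5
        rw [e1, e4, e5, Pi.add_apply, Pi.add_apply, e2, e3, mul_add]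
      map_smul' := fun a F => by
        refine hext ?_
        filter_upwards [hcoe (a • F), hcoe F, Lp.coeFn_smul a F,
          hcoe' (Lp.coeFn_smul a (hmem F).toLp)] with s e1 e2 e3 e4
        rw [e1, e3, RingHom.id_apply, e4, Pi.smul_apply, Pi.smul_apply, e2, smul_eq_mul,
          smul_eq_mul, mul_left_comm] }
  have hL : ∀ F, L F =ᵐ[ν] fun s => ((r : ℝ) : ℂ)⁻¹ * F s := hcoe
  have hnorm : ∀ F, ‖L F‖ = ‖F‖ := by
    intro F
    change ‖(hmem F).toLp‖ = _
    rw [Lp.norm_toLp, Lp.norm_def, eLpNorm_nnreal_smul_measure]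
    congr 1
    have e : eLpNorm (fun s => ((r : ℝ) : ℂ)⁻¹ * F s) 2 ν
        = ‖((r : ℝ) : ℂ)⁻¹‖ₑ * eLpNorm F 2 ν :=
      eLpNorm_const_smul (((r : ℝ) : ℂ)⁻¹) (F : S → ℂ) 2 ν
    have e' : ‖((r : ℝ) : ℂ)⁻¹‖ₑ = ((r⁻¹ : ℝ≥0) : ℝ≥0∞) := by
      rw [enorm_eq_nnnorm]
      congr 1
      ext
      simp
    rw [e, e', ← mul_assoc, ← ENNReal.coe_mul, mul_inv_cancel₀ hr0, ENNReal.coe_one, one_mul]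
  have hsurj : Function.Surjective L := by
    intro G
    have hG : MemLp (fun s => ((r : ℝ) : ℂ) * G s) 2 ν :=
      (memLp_smul_measure_iff hc).1 ((Lp.memLp G).const_mul _)
    refine ⟨hG.toLp, hext ?_⟩
    filter_upwards [hL hG.toLp, MemLp.coeFn_toLp hG] with s e1 e2
    rw [e1, e2, inv_mul_cancel_left₀ hrc]
  refine ⟨LinearIsometryEquiv.ofSurjective ⟨L, hnorm⟩ hsurj, fun g F => hext ?_⟩
  change L (rep χ hν g F) =ᵐ[ν] rep χ hν' g (L F)
  filter_upwards [hL (rep χ hν g F), rep_coeFn (χ := χ) hν g F,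
    hcoe' (rep_coeFn (χ := χ) hν' g (L F)), opFun_congr hν χ (equivQ.symm g).left.toAdd
      (equivQ.symm g).right (hL F)] with s e1 e2 e3 e4
  rw [e1, e2, e3, e4, opFun, opFun, mul_left_comm]

end Equivalence

end Iwasawa

theorem mainTheorem3 (χ : ℤˣ × ℤˣ → Iwasawa.NHat) (hχ : ∀ k, χ k ∈ Iwasawa.charOrbit k) :
    (∀ (k : ℤˣ × ℤˣ) (ν : MeasureTheory.Measure Iwasawa.S) (hν : Iwasawa.IsAlmostInvariant ν),
      Iwasawa.OperatorIrreducible (Iwasawa.rep (χ k) hν) ∧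
        Iwasawa.SpaceIrreducible (Iwasawa.rep (χ k) hν)) ∧
    (∀ (k k' : ℤˣ × ℤˣ) (ν ν' : MeasureTheory.Measure Iwasawa.S)
      (hν : Iwasawa.IsAlmostInvariant ν) (hν' : Iwasawa.IsAlmostInvariant ν'),
      Iwasawa.UnitarilyEquivalent (Iwasawa.rep (χ k) hν) (Iwasawa.rep (χ k') hν') ↔
        (∃ c : NNReal, 0 < c ∧ ν' = c • ν) ∧ k = k') := by
  refine ⟨fun k ν hν => ⟨Iwasawa.operatorIrreducible_rep (hχ k) hν,
    Iwasawa.spaceIrreducible_rep (hχ k) hν⟩, fun k k' ν ν' hν hν' => ⟨fun h => ?_, ?_⟩⟩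
  · obtain rfl : k = k' := by
      by_contra hk
      obtain ⟨U, hU⟩ := h
      have h0 := Iwasawa.eq_zero_of_intertwines_ofN (hχ k) (hχ k') hk hν hν'
        U.toContinuousLinearEquiv.toContinuousLinearMap fun n => hU _
      have := Iwasawa.nontrivial_Lp hν
      obtain ⟨F, hF⟩ := exists_ne (0 : Lp ℂ 2 ν)
      exact hF (U.map_eq_zero_iff.1 (congrArg (fun T : Lp ℂ 2 ν →L[ℂ] Lp ℂ 2 ν' => T F) h0))
    exact ⟨Iwasawa.exists_eq_smul_of_unitarilyEquivalent (hχ k) hν hν' h, rfl⟩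
  · rintro ⟨⟨c, hc, rfl⟩, rfl⟩
    exact Iwasawa.unitarilyEquivalent_smul hc hν hν'
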